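/- Let $E$ be a Euclidean space of dimension $\ell$ with inner product $(\cdot,\cdot)$, and let $\Phi$ be an irreducible crystallographic root system spanning $E$, not necessarily reduced (the empty root system in $E=\{0\}$ is allowed). Let $W$ be its Weyl group, $\Delta=\{\alpha_1,\dots,\alpha_\ell\}$ a set of simple roots, $\tilde\alpha=n_1\alpha_1+\cdots+n_\ell\alpha_\ell$ the highest root ($\tilde\alpha=0$ if $\Phi=\varnothing$), and $n_0=1$. Let $Z=\{x\in E : (\alpha,x)\in\mathbb Z \text{ for all } \alpha\in\Phi\}$ be the coweight lattice, $$A_\circ=\{x\in E : (\alpha_i,x)>0 \text{ for } 1\le i\le\ell,\ (\tilde\alpha,x)<1\}$$ the fundamental alcove, and $$P^\diamond=\{x\in E : 0<(\alpha_i,x)\le 1 \text{ for } 1\le i\le\ell\}$$ the fundamental parallelepiped. The projection $\pi_T:E\to T=E/Z$ restricts to a bijection $P^\diamond\to T$, through which the action of $W$ on $T$ given by $w\cdot\pi_T(x)=\pi_T(w(x))$ is transported to an action $\rho^\diamond$ of $W$ on $P^\diamond$. Let $W_{A_\circ}=\{w\in W : \rho^\diamond(w)(A_\circ)=A_\circ\}$.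 Put $J=\{j\in\{0,\dots,\ell\} : n_j=1\}$. Let $w_0$ be the longest element of $W$ with respect to the simple reflections, for $j\in J\setminus\{0\}$ let $w_j$ be the longest element of the subgroup of $W$ generated by the reflections in the roots of $\Delta\setminus\{\alpha_j\}$, and put $\omega_j=w_jw_0$ for $j\in J$ (so $\omega_0=w_0w_0=1$) and $\Omega=\{\omega_j : j\in J\}$. Then $W_{A_\circ}=\Omega$. Moreover $\Omega$ is also equal to the stabilizer $\{w\in W : w\cdot\pi_T(A_\circ)=\pi_T(A_\circ)\}$ of the image of $A_\circ$ in $T$, and to the image under the projection $Z\rtimes W\to W$ of the stabilizer of $A_\circ$ in the extended affine Weyl group $Z\rtimes W$, in which $(z,w)$ acts on $E$ by $x\mapsto w(x)+z$. -/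

import Mathlib

open scoped Pointwise InnerProductSpace

noncomputable section

namespace RootPairing

variable {ι E : Type*} [NormedAddCommGroup E] [InnerProductSpace ℝ E]

/-- A root pairing of a Euclidean space `E` with itself is Euclidean if the pairing is the inner
product and the coroot of `α` is `2α / (α, α)`. In particular the reflection attached to `α` is the
orthogonal reflection in the hyperplane `(α, x) = 0`. -/
class IsEuclidean (P : RootPairing ι ℝ E E) : Prop where
  toLinearMap_apply : ∀ x y : E, P.toLinearMap x y = ⟪x, y⟫_ℝ
  coroot_eq : ∀ i, P.coroot i = (2 / ⟪P.root i, P.root i⟫_ℝ) • P.root i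

/-- A set of simple roots `α₁, …, α_ℓ`: a basis of `E` made of roots such that every root is a
combination of it with coefficients all in `ℕ` or all in `-ℕ`. (Unlike `RootPairing.Base`, this is
the usual notion for non-reduced root systems too.) -/
structure SimpleRoots (P : RootPairing ι ℝ E E) (ℓ : ℕ) where
  /-- the indices of the simple roots -/
  idx : Fin ℓ → ι
  /-- the simple roots, as a basis of `E` -/
  basis : Module.Basis (Fin ℓ) ℝ E
  basis_apply : ∀ j, basis j = P.root (idx j)
  nonneg_or_nonpos : ∀ i, (∀ j, ∃ n : ℕ, basis.repr (P.root i) j = n) ∨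
    (∀ j, ∃ n : ℕ, basis.repr (P.root i) j = -n)

section Lattice

variable (P : RootPairing ι ℝ E E)

/-- The coweight lattice `Z`. -/
def coweightLattice : AddSubgroup E where
  carrier := {x | ∀ i, ∃ n : ℤ, ⟪P.root i, x⟫_ℝ = n}
  zero_mem' := fun i => ⟨0, by simp⟩
  add_mem' := by
    intro x y hx hy i
    obtain ⟨m, hm⟩ := hx i
    obtain ⟨n, hn⟩ := hy i
    exact ⟨m + n, by rw [inner_add_right, hm, hn]; push_cast; rfl⟩
  neg_mem' := by
    intro x hx i
    obtain ⟨m, hm⟩ := hx i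
    exact ⟨-m, by rw [inner_neg_right, hm]; push_cast; rfl⟩

variable [P.IsEuclidean]

theorem inner_weylGroup_smul (w : P.weylGroup) (x y : E) :
    ⟪w • x, w • y⟫_ℝ = ⟪x, y⟫_ℝ := by
  revert x y
  obtain ⟨g, hg⟩ := w
  induction hg using weylGroup.induction with
  | mem i =>
    intro x y
    have key : ∀ z : E, (⟨Equiv.reflection P i, P.reflection_mem_weylGroup i⟩ : P.weylGroup) • z =
        z - (2 / ⟪P.root i, P.root i⟫_ℝ * ⟪z, P.root i⟫_ℝ) • P.root i := by
      intro z
      change P.reflection i z = _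
      rw [reflection_apply]
      change z - (P.toLinearMap z (P.coroot i)) • P.root i = _
      rw [IsEuclidean.toLinearMap_apply, IsEuclidean.coroot_eq, inner_smul_right]
    have h0 : ⟪P.root i, P.root i⟫_ℝ ≠ 0 := by
      simpa using P.ne_zero i
    rw [key, key]
    simp only [inner_sub_left, inner_sub_right, inner_smul_left, inner_smul_right,
      real_inner_comm (P.root i) y, conj_trivial]
    field_simp
    rw [real_inner_comm y (P.root i)]
    ring
  | one => intro x y; rfl
  | mul g₁ g₂ hg₁ hg₂ h₁ h₂ =>
    intro x y
    rw [← Submonoid.mk_mul_mk _ _ _ hg₁ hg₂, mul_smul, mul_smul]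
    exact (h₁ _ _).trans (h₂ _ _)

theorem smul_mem_coweightLattice (w : P.weylGroup) {x : E} (hx : x ∈ P.coweightLattice) :
    w • x ∈ P.coweightLattice := by
  intro i
  obtain ⟨n, hn⟩ := hx (P.weylGroupToPerm w⁻¹ i)
  refine ⟨n, ?_⟩
  rw [← hn, ← weylGroup_apply_root, ← inner_weylGroup_smul P w (w⁻¹ • P.root i), smul_inv_smul]

/-- The action of the Weyl group `W` on `Z`. -/
instance instActionCoweight : DistribMulAction P.weylGroup P.coweightLattice where
  smul w z := ⟨w • (z : E), P.smul_mem_coweightLattice w z.2⟩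
  one_smul z := Subtype.ext (one_smul _ (z : E))
  mul_smul v w z := Subtype.ext (mul_smul v w (z : E))
  smul_zero w := Subtype.ext (smul_zero w)
  smul_add w y z := Subtype.ext (smul_add w (y : E) (z : E))

/-- The action of `W` on `Z`, as a homomorphism to the automorphism group of `Z` (written
multiplicatively). -/
def coweightAut : P.weylGroup →* MulAut (Multiplicative P.coweightLattice) where
  toFun w := AddEquiv.toMultiplicative (DistribMulAction.toAddEquiv P.coweightLattice w)
  map_one' := MulEquiv.ext fun z => one_smul P.weylGroup (Multiplicative.toAdd z)
  map_mul' v w := MulEquiv.ext fun z => mul_smul v w (Multiplicative.toAdd z)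

/-- The extended affine Weyl group `Z ⋊ W`. -/
abbrev ExtendedAffineWeylGroup : Type _ :=
  Multiplicative P.coweightLattice ⋊[P.coweightAut] P.weylGroup

/-- The element `(z, w)` of `Z ⋊ W` acts on `E` by `x ↦ w x + z`. -/
instance instActionExtended : MulAction P.ExtendedAffineWeylGroup E where
  smul g x := g.right • x + ((Multiplicative.toAdd g.left : P.coweightLattice) : E)
  one_smul x := by
    change (1 : P.weylGroup) • x + ((0 : P.coweightLattice) : E) = x
    simp
  mul_smul g h x := by
    change (g.right * h.right) • x + (((Multiplicative.toAdd g.left : P.coweightLattice) : E) +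
        g.right • ((Multiplicative.toAdd h.left : P.coweightLattice) : E)) =
      g.right • (h.right • x + ((Multiplicative.toAdd h.left : P.coweightLattice) : E)) +
        ((Multiplicative.toAdd g.left : P.coweightLattice) : E)
    rw [smul_add, mul_smul]
    abel

/-- The projection `π : Z ⋊ W → W`. -/
def projWeyl : P.ExtendedAffineWeylGroup →* P.weylGroup :=
  SemidirectProduct.rightHom

/-- The torus `T = E / Z`. -/
abbrev Torus : Type _ := E ⧸ P.coweightLattice

/-- The projection `π_T : E → T`. -/
abbrev toTorus (x : E) : P.Torus := QuotientAddGroup.mk x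

/-- The action `ρ_T` of `W` on `T`, induced by the action on `E`. -/
instance instActionTorus : MulAction P.weylGroup P.Torus where
  smul w := QuotientAddGroup.map P.coweightLattice P.coweightLattice
    (DistribSMul.toAddMonoidHom E w) (fun _ hx => P.smul_mem_coweightLattice w hx)
  one_smul t := by
    induction t using QuotientAddGroup.induction_on with
    | H x => exact congrArg P.toTorus (one_smul P.weylGroup x)
  mul_smul v w t := by
    induction t using QuotientAddGroup.induction_on with
    | H x => exact congrArg P.toTorus (mul_smul v w x)

end Lattice

end RootPairing

/-- Word length in a group with respect to a set `S` of generators that is closed under inversion: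
the least length of a list of elements of `S` with product `g`. (It is only used for `g` in the
subgroup generated by `S`.) -/
def wordLength {G : Type*} [Group G] (S : Set G) (g : G) : ℕ :=
  sInf {n | ∃ l : List G, l.length = n ∧ (∀ s ∈ l, s ∈ S) ∧ l.prod = g}

/-- `g` is a longest element of the group generated by `S`. -/
def IsLongestElement {G : Type*} [Group G] (S : Set G) (g : G) : Prop :=
  g ∈ Subgroup.closure S ∧ ∀ h ∈ Subgroup.closure S, wordLength S h ≤ wordLength S g

namespace RootPairing.SimpleRoots

variable {ι E : Type*} [NormedAddCommGroup E] [InnerProductSpace ℝ E]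
  {P : RootPairing ι ℝ E E} {ℓ : ℕ} (b : P.SimpleRoots ℓ)

open Classical in
/-- The highest root: the root whose coefficients on the simple roots are at least those of every
other root. For the empty root system (in the zero space) this is `0`. -/
def highestRoot : E :=
  if h : ∃ i, ∀ k j, b.basis.repr (P.root k) j ≤ b.basis.repr (P.root i) j then
    P.root h.choose else 0

/-- `n₀ = 1` and `n₁, …, n_ℓ` are the coefficients of the highest root. -/
def mark : Fin (ℓ + 1) → ℝ :=
  Fin.cons 1 (fun j => b.basis.repr b.highestRoot j)

/-- The index set `J` of all `j ∈ {0, …, ℓ}` with `n_j = 1`. -/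
def J : Set (Fin (ℓ + 1)) := {j | b.mark j = 1}

/-- The fundamental alcove. -/
def fundamentalAlcove : Set E :=
  {x | (∀ j, 0 < ⟪b.basis j, x⟫_ℝ) ∧ ⟪b.highestRoot, x⟫_ℝ < 1}

/-- The reflections in the simple roots other than `α_j`, where `j = k + 1` stands for the simple
root of index `k`; for `j = 0` these are all the simple reflections. -/
def simpleReflectionsOmitting (j : Fin (ℓ + 1)) : Set P.weylGroup :=
  {s | ∃ k : Fin ℓ, k.succ ≠ j ∧ s = weylGroup.ofIdx P (b.idx k)}

/-- The set `Ω` of the elements `ω_j = w_j w_0`, `j ∈ J`, where `w_0` is the longest element of `W`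
and `w_j` the longest element of the Weyl group of `Δ \ {α_j}` (so `ω_0 = w_0 w_0`). -/
def Omega : Set P.weylGroup :=
  {ω | ∃ j ∈ b.J, ∃ wj w0 : P.weylGroup,
    IsLongestElement (b.simpleReflectionsOmitting j) wj ∧
    IsLongestElement (b.simpleReflectionsOmitting 0) w0 ∧ ω = wj * w0}

/-- The fundamental parallelepiped `P^⋄` of `Z`. -/
def parallelepiped : Set E :=
  {x | ∀ j, 0 < ⟪b.basis j, x⟫_ℝ ∧ ⟪b.basis j, x⟫_ℝ ≤ 1}

theorem mem_coweightLattice_of_basis {x : E}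
    (hx : ∀ j, ∃ n : ℤ, ⟪b.basis j, x⟫_ℝ = n) : x ∈ P.coweightLattice := by
  intro i
  choose f hf using hx
  have hc : ∀ j, ∃ n : ℤ, b.basis.repr (P.root i) j = n := by
    rcases b.nonneg_or_nonpos i with h | h
    · exact fun j => (h j).elim fun n hn => ⟨n, by rw [hn]; norm_cast⟩
    · exact fun j => (h j).elim fun n hn => ⟨-n, by rw [hn]; push_cast; rfl⟩
  choose c hc using hc
  refine ⟨∑ j, c j * f j, ?_⟩
  rw [← b.basis.sum_repr (P.root i), sum_inner]
  push_cast
  exact Finset.sum_congr rfl fun j _ => by rw [real_inner_smul_left, hc, hf]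

theorem exists_inner_basis (c : Fin ℓ → ℝ) : ∃ x : E, ∀ j, ⟪b.basis j, x⟫_ℝ = c j := by
  have : FiniteDimensional ℝ E := b.basis.finiteDimensional_of_finite
  refine ⟨(InnerProductSpace.toDual ℝ E).symm
    (LinearMap.toContinuousLinearMap (b.basis.constr ℝ c)), fun j => ?_⟩
  rw [real_inner_comm, InnerProductSpace.toDual_symm_apply]
  simp

/-- The restriction of `π_T` to `P^⋄` is a bijection onto `T`. -/
theorem bijective_toTorus :
    Function.Bijective (fun x : b.parallelepiped => P.toTorus (x : E)) := by
  constructor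
  · rintro ⟨x, hx⟩ ⟨y, hy⟩ hxy
    have hz : -x + y ∈ P.coweightLattice := QuotientAddGroup.eq.mp hxy
    apply Subtype.ext
    refine InnerProductSpace.ext_inner_left_basis b.basis fun j => ?_
    obtain ⟨n, hn⟩ := hz (b.idx j)
    rw [← b.basis_apply, inner_add_right, inner_neg_right] at hn
    have h1 := hx j
    have h2 := hy j
    have hlt : (n : ℝ) < 1 := by linarith [h1.1, h2.2]
    have hgt : (-1 : ℝ) < n := by linarith [h1.2, h2.1]
    have hlt' : n < 1 := by exact_mod_cast hlt
    have hgt' : -1 < n := by exact_mod_cast hgt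
    have h0 : n = 0 := by omega
    rw [h0] at hn
    push_cast at hn
    change ⟪b.basis j, x⟫_ℝ = ⟪b.basis j, y⟫_ℝ
    linarith
  · intro t
    induction t using QuotientAddGroup.induction_on with
    | H x =>
      obtain ⟨z, hz⟩ := b.exists_inner_basis (fun j => 1 - (⌈⟪b.basis j, x⟫_ℝ⌉ : ℝ))
      have hzZ : z ∈ P.coweightLattice :=
        b.mem_coweightLattice_of_basis fun j => ⟨1 - ⌈⟪b.basis j, x⟫_ℝ⌉, by rw [hz]; push_cast; rfl⟩
      refine ⟨⟨x + z, fun j => ?_⟩, ?_⟩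
      · rw [inner_add_right, hz]
        constructor
        · linarith [Int.ceil_lt_add_one ⟪b.basis j, x⟫_ℝ]
        · linarith [Int.le_ceil ⟪b.basis j, x⟫_ℝ]
      · refine (QuotientAddGroup.eq.mpr ?_)
        simpa using hzZ

/-- The bijection from `P^⋄` to `T` obtained by restricting `π_T`. -/
def parallelepipedEquiv : b.parallelepiped ≃ P.Torus :=
  Equiv.ofBijective _ b.bijective_toTorus

variable [P.IsEuclidean]

/-- The action `ρ^⋄` of `W` on `P^⋄`, transported from the action on `T`. -/
def rho (w : P.weylGroup) (x : b.parallelepiped) : b.parallelepiped :=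
  b.parallelepipedEquiv.symm (w • b.parallelepipedEquiv x)

/-- The stabilizer `W_C` of a subset `C` of `P^⋄` under `ρ^⋄`. -/
def stabilizer (C : Set E) : Set P.weylGroup :=
  {w | (fun x : b.parallelepiped => (b.rho w x : E)) '' {x | (x : E) ∈ C} = C}

end RootPairing.SimpleRoots

end

/-! On the alcove each root takes values in `(0, 1)` or in `(-1, 0)`, so no hyperplane `(α, x) = m`
with `m` an integer meets it. The group `Z ⋊ W` permutes these hyperplanes, hence an element
carrying one point of the alcove into the alcove stabilizes it (`extended_smul_mem`). So `w`
stabilizes the image of the alcove in `T` exactly when some `(z, w)` stabilizes the alcove itself.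
Since the alcove lies in `P^⋄`, the stabilizer under `ρ^⋄` is the same group.

It remains to find the stabilizing pairs `(z, w)`. The numbers `(α_i, z)` are integers in `(-1, 2)`,
and `(α̃, z) < 2` while all `n_i ≥ 1`; so `z` is `0` or a fundamental coweight with `n_j = 1`.
Conversely, for `j ∈ J` the map `x ↦ w_j w_0 x + z` stabilizes the alcove, because of the signs of
the roots `w_0⁻¹ w_j⁻¹ α_i` and `w_0⁻¹ w_j⁻¹ α̃`. Two stabilizing pairs with the same `z` differ by
an element of `W` preserving the alcove. It preserves positivity of roots, so it is `1`.

Two facts carry this: the exchange property (`exists_shorter_word`), which gives the freeness of `W`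
and the sign behaviour of longest elements, and the dominance of `α̃` over all roots, which comes
from irreducibility. -/

namespace RootPairing

variable {ι E : Type*} [NormedAddCommGroup E] [InnerProductSpace ℝ E]
  (P : RootPairing ι ℝ E E)

/-! ### The Weyl group as a finite group of isometries -/

theorem weylGroup_ext {v w : P.weylGroup} (h : ∀ x : E, v • x = w • x) : v = w :=
  Subtype.ext <| Equiv.weightHom_injective P <| LinearEquiv.ext h

theorem weylGroup_smul_real (w : P.weylGroup) (c : ℝ) (x : E) : w • c • x = c • w • x :=
  map_smul (Equiv.weightEquiv P P (w : P.Aut)) c x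

theorem weylGroup_smul_mem_range_root (w : P.weylGroup) {v : E} (hv : v ∈ Set.range P.root) :
    w • v ∈ Set.range P.root := by
  obtain ⟨i, rfl⟩ := hv
  exact ⟨_, (P.weylGroup_apply_root w i).symm⟩

theorem neg_mem_range_root {v : E} (hv : v ∈ Set.range P.root) : -v ∈ Set.range P.root := by
  obtain ⟨i, rfl⟩ := hv
  exact ⟨P.reflectionPerm i i, by simp⟩

/-- The roots span, so an element is determined by its permutation of them. Finiteness is what
provides longest elements. -/
theorem weylGroup_finite [Finite ι] [P.IsRootSystem] : Finite P.weylGroup := by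
  refine Finite.of_injective (fun w => P.weylGroupToPerm w) fun v w h => P.weylGroup_ext fun x => ?_
  have hx : x ∈ Submodule.span ℝ (Set.range P.root) := by simp
  induction hx using Submodule.span_induction with
  | mem x hx =>
    obtain ⟨i, rfl⟩ := hx
    rw [weylGroup_apply_root, weylGroup_apply_root]
    exact congrArg (fun f : Equiv.Perm ι => P.root (f i)) h
  | zero => simp
  | add x y _ _ hx hy => rw [smul_add, smul_add, hx, hy]
  | smul c x _ hx => rw [weylGroup_smul_real, weylGroup_smul_real, hx]

theorem weylGroup_ofIdx_inv (i : ι) : (weylGroup.ofIdx P i)⁻¹ = weylGroup.ofIdx P i :=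
  Subtype.ext (Equiv.reflection_inv P i)

theorem weylGroup_ofIdx_mul_self (i : ι) : weylGroup.ofIdx P i * weylGroup.ofIdx P i = 1 := by
  rw [mul_eq_one_iff_inv_eq, weylGroup_ofIdx_inv]

theorem inner_root_self_pos (i : ι) : 0 < ⟪P.root i, P.root i⟫_ℝ :=
  real_inner_self_pos.2 (P.ne_zero i)

section Euclidean

variable [P.IsEuclidean]

theorem pairing_eq_inner (i j : ι) :
    P.pairing i j = 2 / ⟪P.root j, P.root j⟫_ℝ * ⟪P.root i, P.root j⟫_ℝ := by
  change P.toLinearMap (P.root i) (P.coroot j) = _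
  rw [IsEuclidean.toLinearMap_apply, IsEuclidean.coroot_eq, inner_smul_right]

theorem ofIdx_smul_eq (i : ι) (x : E) :
    weylGroup.ofIdx P i • x =
      x - (2 / ⟪P.root i, P.root i⟫_ℝ * ⟪x, P.root i⟫_ℝ) • P.root i := by
  change P.reflection i x = _
  rw [reflection_apply]
  change x - (P.toLinearMap x (P.coroot i)) • P.root i = _
  rw [IsEuclidean.toLinearMap_apply, IsEuclidean.coroot_eq, inner_smul_right]

theorem inner_weylGroup_smul_right (w : P.weylGroup) (x y : E) :
    ⟪x, w • y⟫_ℝ = ⟪w⁻¹ • x, y⟫_ℝ := by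
  rw [← P.inner_weylGroup_smul w (w⁻¹ • x), smul_inv_smul]

/-- An element of the Weyl group which maps `α` to a multiple of `β` conjugates the reflection in
`α` to the reflection in `β`. -/
theorem conj_ofIdx_eq_of_smul_root (w : P.weylGroup) {i j : ι} {c : ℝ}
    (h : w • P.root i = c • P.root j) :
    w * weylGroup.ofIdx P i * w⁻¹ = weylGroup.ofIdx P j := by
  have hc : c ≠ 0 := by
    rintro rfl
    rw [zero_smul, weylGroup_apply_root] at h
    exact P.ne_zero _ h
  refine P.weylGroup_ext fun x => ?_
  have h1 : ⟪P.root i, P.root i⟫_ℝ = c * c * ⟪P.root j, P.root j⟫_ℝ := by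
    rw [← P.inner_weylGroup_smul w, h, real_inner_smul_left, real_inner_smul_right]
    ring
  have h2 : ⟪w⁻¹ • x, P.root i⟫_ℝ = c * ⟪x, P.root j⟫_ℝ := by
    rw [← P.inner_weylGroup_smul w, h, smul_inv_smul, real_inner_smul_right]
  have h3 := (P.inner_root_self_pos j).ne'
  rw [mul_smul, mul_smul, ofIdx_smul_eq, smul_sub, smul_inv_smul, weylGroup_smul_real, h,
    ofIdx_smul_eq, h1, h2, smul_smul]
  congr 2
  field_simp

end Euclidean

/-! ### Positive roots and the exchange property -/

namespace SimpleRoots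

variable {P} {ℓ : ℕ} (b : P.SimpleRoots ℓ)

/-- Positive roots with respect to a set of simple roots. -/
def IsPos (v : E) : Prop := v ∈ Set.range P.root ∧ ∀ j, 0 ≤ b.basis.repr v j

/-- The reflection in a simple root, as an element of the Weyl group. -/
noncomputable abbrev simpleReflection (k : Fin ℓ) : P.weylGroup := weylGroup.ofIdx P (b.idx k)

variable {b}

theorem basis_mem_range_root (k : Fin ℓ) : b.basis k ∈ Set.range P.root :=
  ⟨_, (b.basis_apply k).symm⟩

theorem isPos_basis (k : Fin ℓ) : b.IsPos (b.basis k) :=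
  ⟨basis_mem_range_root k, fun j => by
    rw [Module.Basis.repr_self, Finsupp.single_apply]; split_ifs <;> norm_num⟩

theorem isPos_or_isPos_neg {v : E} (hv : v ∈ Set.range P.root) : b.IsPos v ∨ b.IsPos (-v) := by
  obtain ⟨i, rfl⟩ := hv
  rcases b.nonneg_or_nonpos i with h | h
  · refine .inl ⟨⟨i, rfl⟩, fun j => ?_⟩
    obtain ⟨n, hn⟩ := h j
    rw [hn]
    positivity
  · refine .inr ⟨P.neg_mem_range_root ⟨i, rfl⟩, fun j => ?_⟩
    obtain ⟨n, hn⟩ := h j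
    simp [hn]

theorem IsPos.not_neg {v : E} (hv : b.IsPos v) : ¬ b.IsPos (-v) := by
  intro h
  obtain ⟨⟨i, rfl⟩, hv⟩ := hv
  refine P.ne_zero i (b.basis.ext_elem fun j => ?_)
  have h1 := h.2 j
  have h2 := hv j
  simp only [map_neg, Finsupp.neg_apply, Left.nonneg_neg_iff] at h1
  simp only [map_zero, Finsupp.coe_zero, Pi.zero_apply]
  exact le_antisymm h1 h2

theorem isPos_neg_of_not {v : E} (hv : v ∈ Set.range P.root) (h : ¬ b.IsPos v) : b.IsPos (-v) :=
  (isPos_or_isPos_neg hv).resolve_left h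

theorem isPos_of_repr_pos {v : E} (hv : v ∈ Set.range P.root) {j : Fin ℓ}
    (h : 0 < b.basis.repr v j) : b.IsPos v := by
  refine (isPos_or_isPos_neg hv).resolve_right fun h' => ?_
  have := h'.2 j
  simp only [map_neg, Finsupp.neg_apply] at this
  linarith

theorem exists_int_repr {v : E} (hv : v ∈ Set.range P.root) (j : Fin ℓ) :
    ∃ n : ℤ, b.basis.repr v j = n := by
  obtain ⟨i, rfl⟩ := hv
  rcases b.nonneg_or_nonpos i with h | h
  · obtain ⟨n, hn⟩ := h j
    exact ⟨n, by rw [hn]; norm_cast⟩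
  · obtain ⟨n, hn⟩ := h j
    exact ⟨-n, by rw [hn]; push_cast; rfl⟩

theorem IsPos.exists_nat_repr {v : E} (hv : b.IsPos v) (j : Fin ℓ) :
    ∃ n : ℕ, b.basis.repr v j = n := by
  obtain ⟨n, hn⟩ := exists_int_repr hv.1 j
  have h0 := hv.2 j
  rw [hn] at h0
  lift n to ℕ using by exact_mod_cast h0
  exact ⟨n, by rw [hn]; norm_cast⟩

theorem IsPos.exists_nat_height {v : E} (hv : b.IsPos v) :
    ∃ n : ℕ, ∑ j, b.basis.repr v j = n := by
  choose f hf using hv.exists_nat_repr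
  exact ⟨∑ j, f j, by push_cast; exact Finset.sum_congr rfl fun j _ => hf j⟩

theorem IsPos.exists_repr_pos {v : E} (hv : b.IsPos v) : ∃ j, 0 < b.basis.repr v j := by
  by_contra! h
  obtain ⟨⟨i, rfl⟩, hv⟩ := hv
  refine P.ne_zero i (b.basis.ext_elem fun j => ?_)
  simpa using le_antisymm (h j) (hv j)

theorem inner_eq_sum (v x : E) : ⟪v, x⟫_ℝ = ∑ j, b.basis.repr v j * ⟪b.basis j, x⟫_ℝ := by
  conv_lhs => rw [← b.basis.sum_repr v, sum_inner]
  exact Finset.sum_congr rfl fun j _ => by rw [real_inner_smul_left]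

variable [P.IsEuclidean]

theorem simpleReflection_smul (k : Fin ℓ) (x : E) : b.simpleReflection k • x =
    x - (2 / ⟪b.basis k, b.basis k⟫_ℝ * ⟪x, b.basis k⟫_ℝ) • b.basis k := by
  rw [b.basis_apply, ofIdx_smul_eq]

theorem simpleReflection_smul_self (k : Fin ℓ) : b.simpleReflection k • b.basis k = -b.basis k := by
  have h : ⟪b.basis k, b.basis k⟫_ℝ ≠ 0 := inner_self_ne_zero.2 (b.basis.ne_zero k)
  rw [simpleReflection_smul, div_mul_cancel₀ _ h]
  module

theorem repr_simpleReflection_of_ne {k j : Fin ℓ} (h : j ≠ k) (x : E) :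
    b.basis.repr (b.simpleReflection k • x) j = b.basis.repr x j := by
  rw [simpleReflection_smul]
  simp [h.symm]

theorem repr_simpleReflection_self (k : Fin ℓ) (x : E) :
    b.basis.repr (b.simpleReflection k • x) k =
      b.basis.repr x k - 2 / ⟪b.basis k, b.basis k⟫_ℝ * ⟪x, b.basis k⟫_ℝ := by
  rw [simpleReflection_smul]
  simp

/-- A simple reflection permutes the positive roots that are not multiples of its root. -/
theorem IsPos.simpleReflection_smul_or {v : E} (hv : b.IsPos v) (k : Fin ℓ) :
    b.IsPos (b.simpleReflection k • v) ∨ v = b.basis.repr v k • b.basis k := by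
  -- The reflection changes only the coefficient at `k`, and one positive coefficient already makes
  -- a root positive. Multiples of the simple root have to be allowed because the system may be
  -- non-reduced.
  by_cases h : ∃ j, j ≠ k ∧ 0 < b.basis.repr v j
  · obtain ⟨j, hj, h⟩ := h
    left
    refine isPos_of_repr_pos (P.weylGroup_smul_mem_range_root _ hv.1) (j := j) ?_
    rwa [repr_simpleReflection_of_ne hj]
  · right
    push Not at h
    refine b.basis.ext_elem fun j => ?_
    rcases eq_or_ne j k with rfl | hj
    · simp
    · simpa [Finsupp.single_apply, hj.symm] using le_antisymm (h j hj) (hv.2 j)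

/-- The exchange property. -/
theorem exists_shorter_word {S : Set P.weylGroup} (hS : S ⊆ Set.range b.simpleReflection)
    (k : Fin ℓ) (l : List P.weylGroup) (hl : ∀ s ∈ l, s ∈ S)
    (h : ¬ b.IsPos (l.prod • b.basis k)) :
    ∃ l' : List P.weylGroup, l'.length + 1 = l.length ∧ (∀ s ∈ l', s ∈ S) ∧
      l'.prod = l.prod * b.simpleReflection k := by
  induction l with
  | nil => exact absurd (by simpa using isPos_basis k) h
  | cons s l ih =>
    rw [List.forall_mem_cons] at hl
    by_cases h' : b.IsPos (l.prod • b.basis k)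
    · obtain ⟨i, rfl⟩ := hS hl.1
      refine ⟨l, rfl, hl.2, ?_⟩
      rw [List.prod_cons, mul_smul] at h
      -- The letter `s_i` turns a positive root negative, so that root is a multiple of `α_i`.
      -- Conjugating `s_k` by the rest of the word therefore gives `s_i`, and this letter can be
      -- deleted.
      have hc := (h'.simpleReflection_smul_or i).resolve_left h
      rw [b.basis_apply, b.basis_apply] at hc
      have key := P.conj_ofIdx_eq_of_smul_root _ hc
      have key : l.prod * b.simpleReflection k = b.simpleReflection i * l.prod :=
        mul_inv_eq_iff_eq_mul.1 (P.conj_ofIdx_eq_of_smul_root _ hc)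
      rw [List.prod_cons, mul_assoc, key, ← mul_assoc, P.weylGroup_ofIdx_mul_self, one_mul]
    · obtain ⟨l', h1, h2, h3⟩ := ih hl.2 h'
      refine ⟨s :: l', by simp [h1], List.forall_mem_cons.2 ⟨hl.1, h2⟩, ?_⟩
      rw [List.prod_cons, h3, List.prod_cons, mul_assoc]

end SimpleRoots

end RootPairing

/-! ### Word length and longest elements in a group -/

section WordLength

variable {G : Type*} [Group G] {S : Set G}

theorem exists_list_of_mem_closure (hS : ∀ s ∈ S, s⁻¹ ∈ S) {g : G}
    (hg : g ∈ Subgroup.closure S) : ∃ l : List G, (∀ s ∈ l, s ∈ S) ∧ l.prod = g := by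
  rw [← Subgroup.mem_toSubmonoid, Subgroup.closure_toSubmonoid] at hg
  obtain ⟨l, hl, rfl⟩ := Submonoid.exists_list_of_mem_closure hg
  refine ⟨l, fun s hs => (hl s hs).elim id fun h => ?_, rfl⟩
  simpa using hS _ h

theorem exists_list_length_eq_wordLength (hS : ∀ s ∈ S, s⁻¹ ∈ S) {g : G}
    (hg : g ∈ Subgroup.closure S) :
    ∃ l : List G, l.length = wordLength S g ∧ (∀ s ∈ l, s ∈ S) ∧ l.prod = g := by
  obtain ⟨l, hl, hp⟩ := exists_list_of_mem_closure hS hg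
  exact Nat.sInf_mem (s := {n | ∃ l : List G, l.length = n ∧ (∀ s ∈ l, s ∈ S) ∧ l.prod = g})
    ⟨l.length, l, rfl, hl, hp⟩

theorem wordLength_prod_le {l : List G} (hl : ∀ s ∈ l, s ∈ S) :
    wordLength S l.prod ≤ l.length :=
  Nat.sInf_le ⟨l, rfl, hl, rfl⟩

theorem wordLength_inv_le (hS : ∀ s ∈ S, s⁻¹ ∈ S) {g : G} (hg : g ∈ Subgroup.closure S) :
    wordLength S g⁻¹ ≤ wordLength S g := by
  obtain ⟨l, h1, h2, rfl⟩ := exists_list_length_eq_wordLength hS hg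
  rw [← h1, List.prod_inv_reverse]
  refine (wordLength_prod_le fun s hs => ?_).trans_eq (by simp)
  simp only [List.mem_reverse, List.mem_map] at hs
  obtain ⟨t, ht, rfl⟩ := hs
  exact hS t (h2 t ht)

/-- Inner products move `w` across as `w⁻¹`. This makes the inverses available without knowing that
longest elements are unique or involutions. -/
theorem IsLongestElement.inv (hS : ∀ s ∈ S, s⁻¹ ∈ S) {g : G} (hg : IsLongestElement S g) :
    IsLongestElement S g⁻¹ := by
  refine ⟨inv_mem hg.1, fun h hh => (hg.2 h hh).trans ?_⟩
  simpa using wordLength_inv_le hS (inv_mem hg.1)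

theorem exists_isLongestElement [Finite G] (S : Set G) : ∃ g, IsLongestElement S g := by
  obtain ⟨g, hg, h⟩ := Set.exists_max_image (Subgroup.closure S : Set G) (wordLength S)
    (Set.toFinite _) ⟨1, one_mem _⟩
  exact ⟨g, hg, h⟩

end WordLength

/-! ### Generation by simple reflections and signs under longest elements -/

namespace RootPairing.SimpleRoots

variable {ι E : Type*} [NormedAddCommGroup E] [InnerProductSpace ℝ E]
  {P : RootPairing ι ℝ E E} {ℓ : ℕ} {b : P.SimpleRoots ℓ}

theorem simpleReflectionsOmitting_subset (j : Fin (ℓ + 1)) :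
    b.simpleReflectionsOmitting j ⊆ Set.range b.simpleReflection := by
  rintro _ ⟨k, -, rfl⟩
  exact ⟨k, rfl⟩

theorem inv_mem_simpleReflectionsOmitting (j : Fin (ℓ + 1)) :
    ∀ s ∈ b.simpleReflectionsOmitting j, s⁻¹ ∈ b.simpleReflectionsOmitting j := by
  rintro _ ⟨k, hk, rfl⟩
  exact ⟨k, hk, P.weylGroup_ofIdx_inv _⟩

theorem IsPos.exists_inner_pos {v : E} (hv : b.IsPos v) : ∃ k, 0 < ⟪v, b.basis k⟫_ℝ := by
  by_contra! h
  have h0 : 0 < ⟪v, v⟫_ℝ := by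
    obtain ⟨i, rfl⟩ := hv.1
    exact P.inner_root_self_pos i
  rw [inner_eq_sum (b := b)] at h0
  refine h0.not_ge (Finset.sum_nonpos fun j _ => mul_nonpos_of_nonneg_of_nonpos (hv.2 j) ?_)
  rw [real_inner_comm]
  exact h j

variable [P.IsEuclidean]

/-- Every positive root is, up to a factor, conjugate to a simple root under the group generated by
the simple reflections. -/
theorem IsPos.exists_smul_basis {v : E} (hv : b.IsPos v) :
    ∃ w ∈ Subgroup.closure (Set.range b.simpleReflection), ∃ (k : Fin ℓ) (c : ℝ),
      w • b.basis k = c • v := by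
  obtain ⟨n, hn⟩ := hv.exists_nat_height
  induction n using Nat.strong_induction_on generalizing v with
  | _ n ih =>
    obtain ⟨k, hk⟩ := hv.exists_inner_pos
    rcases hv.simpleReflection_smul_or k with h | h
    · obtain ⟨m, hm⟩ := h.exists_nat_height
      -- Reflecting in a simple root with positive inner product lowers one coefficient and fixes
      -- the others, so the height, a natural number, drops.
      have hlt : m < n := by
        have hpos : 0 < 2 / ⟪b.basis k, b.basis k⟫_ℝ * ⟪v, b.basis k⟫_ℝ :=
          mul_pos (div_pos two_pos (real_inner_self_pos.2 (b.basis.ne_zero k))) hk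
        rw [← @Nat.cast_lt ℝ, ← hm, ← hn]
        refine Finset.sum_lt_sum (fun j _ => ?_) ⟨k, Finset.mem_univ k, ?_⟩
        · rcases eq_or_ne j k with rfl | hj
          · rw [repr_simpleReflection_self]
            linarith
          · rw [repr_simpleReflection_of_ne hj]
        · rw [repr_simpleReflection_self]
          linarith
      obtain ⟨w, hw, k', c, hc⟩ := ih m hlt h hm
      refine ⟨b.simpleReflection k * w, mul_mem (Subgroup.subset_closure ⟨k, rfl⟩) hw, k', c, ?_⟩
      rw [mul_smul, hc, weylGroup_smul_real, ← mul_smul, weylGroup_ofIdx_mul_self, one_smul]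
    · have hne : b.basis.repr v k ≠ 0 := by
        intro h0
        rw [h, h0, zero_smul, inner_zero_left] at hk
        exact hk.false
      refine ⟨1, one_mem _, k, (b.basis.repr v k)⁻¹, ?_⟩
      rw [one_smul, eq_inv_smul_iff₀ hne]
      exact h.symm

theorem closure_range_simpleReflection : Subgroup.closure (Set.range b.simpleReflection) = ⊤ := by
  have key : ∀ i, weylGroup.ofIdx P i ∈ Subgroup.closure (Set.range b.simpleReflection) := by
    intro i
    have : ∃ w ∈ Subgroup.closure (Set.range b.simpleReflection), ∃ (k : Fin ℓ) (c : ℝ),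
        w • b.basis k = c • P.root i := by
      rcases isPos_or_isPos_neg (b := b) ⟨i, rfl⟩ with h | h
      · exact h.exists_smul_basis
      · obtain ⟨w, hw, k, c, hc⟩ := h.exists_smul_basis
        exact ⟨w, hw, k, -c, by rw [hc, smul_neg, neg_smul]⟩
    obtain ⟨w, hw, k, c, hc⟩ := this
    rw [b.basis_apply] at hc
    rw [← P.conj_ofIdx_eq_of_smul_root w hc]
    exact mul_mem (mul_mem hw (Subgroup.subset_closure ⟨k, rfl⟩)) (inv_mem hw)
  rw [eq_top_iff]
  rintro ⟨g, hg⟩ -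
  induction hg using weylGroup.induction with
  | mem i => exact key i
  | one => exact one_mem _
  | mul x y hx hy h1 h2 => exact mul_mem h1 h2

/-- The Weyl group acts freely on the sets of positive roots. -/
theorem eq_one_of_forall_isPos_smul {w : P.weylGroup} (h : ∀ k, b.IsPos (w • b.basis k)) :
    w = 1 := by
  set S := Set.range b.simpleReflection with hS
  have hinv : ∀ s ∈ S, s⁻¹ ∈ S := by
    rintro _ ⟨k, rfl⟩
    exact ⟨k, (P.weylGroup_ofIdx_inv _).symm⟩
  have hw : w ∈ Subgroup.closure S := by
    rw [closure_range_simpleReflection]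
    exact Subgroup.mem_top w
  obtain ⟨l, hlen, hl, rfl⟩ := exists_list_length_eq_wordLength hinv hw
  rcases l.eq_nil_or_concat with rfl | ⟨l, s, rfl⟩
  · rfl
  · exfalso
    simp only [List.concat_eq_append, List.mem_append, List.mem_singleton, List.prod_append,
      List.prod_singleton, List.length_append, List.length_singleton] at hl hlen h
    obtain ⟨k, rfl⟩ := hl s (.inr rfl)
    -- In a shortest word ending in `s_k`, positivity of the image of `α_k` forces the rest of the
    -- word to send `α_k` to a negative root. Exchange then yields a word shorter by two.
    have hneg : ¬ b.IsPos (l.prod • b.basis k) := by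
      have := (h k).not_neg
      rwa [mul_smul, simpleReflection_smul_self, smul_neg, neg_neg] at this
    obtain ⟨l', h1, h2, h3⟩ := exists_shorter_word (S := S) le_rfl k l (fun s hs => hl s (.inl hs)) hneg
    have := wordLength_prod_le h2
    rw [h3] at this
    omega

/-- If `w α_k` were positive, then `w s_k` would send `α_k` to a negative root, and exchange would
make `w` shorter than `w s_k`. -/
theorem not_isPos_smul_of_isLongestElement {j : Fin (ℓ + 1)} {w : P.weylGroup}
    (hw : IsLongestElement (b.simpleReflectionsOmitting j) w) {k : Fin ℓ} (hk : k.succ ≠ j) :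
    ¬ b.IsPos (w • b.basis k) := by
  intro h
  have hs : b.simpleReflection k ∈ b.simpleReflectionsOmitting j := ⟨k, hk, rfl⟩
  have hmem := mul_mem hw.1 (Subgroup.subset_closure hs)
  obtain ⟨l, h1, h2, h3⟩ :=
    exists_list_length_eq_wordLength (inv_mem_simpleReflectionsOmitting j) hmem
  have hneg : ¬ b.IsPos (l.prod • b.basis k) := by
    rw [h3, mul_smul, simpleReflection_smul_self, smul_neg]
    exact h.not_neg
  obtain ⟨l', h4, h5, h6⟩ := exists_shorter_word (simpleReflectionsOmitting_subset j) k l h2 hneg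
  have h7 := wordLength_prod_le h5
  rw [h6, h3, mul_assoc, weylGroup_ofIdx_mul_self, mul_one] at h7
  have := hw.2 _ hmem
  omega

/-- The longest element of the parabolic subgroup omitting `α_j` sends the other simple roots to
negative roots. -/
theorem isPos_neg_smul_of_isLongestElement {j : Fin (ℓ + 1)} {w : P.weylGroup}
    (hw : IsLongestElement (b.simpleReflectionsOmitting j) w) {k : Fin ℓ} (hk : k.succ ≠ j) :
    b.IsPos (-(w • b.basis k)) :=
  isPos_neg_of_not (P.weylGroup_smul_mem_range_root _ (basis_mem_range_root k))
    (not_isPos_smul_of_isLongestElement hw hk)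

/-- The longest element of the Weyl group exchanges positive and negative roots. -/
theorem IsPos.neg_smul_of_isLongestElement {w : P.weylGroup}
    (hw : IsLongestElement (b.simpleReflectionsOmitting 0) w) {v : E} (hv : b.IsPos v) :
    b.IsPos (-(w • v)) := by
  refine ⟨P.neg_mem_range_root (P.weylGroup_smul_mem_range_root _ hv.1), fun j => ?_⟩
  have h : -(w • v) = ∑ k, b.basis.repr v k • -(w • b.basis k) := by
    conv_lhs => rw [← b.basis.sum_repr v, Finset.smul_sum, ← Finset.sum_neg_distrib]
    exact Finset.sum_congr rfl fun k _ => by rw [weylGroup_smul_real, smul_neg]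
  rw [h, map_sum, Finsupp.finsetSum_apply]
  refine Finset.sum_nonneg fun k _ => ?_
  rw [map_smul, Finsupp.smul_apply, smul_eq_mul]
  exact mul_nonneg (hv.2 k)
    ((isPos_neg_smul_of_isLongestElement hw (Fin.succ_ne_zero k)).2 j)

/-- The parabolic subgroup omitting `α_k` preserves the coefficients at `α_k`. -/
theorem repr_smul_of_mem_closure {k : Fin ℓ} {w : P.weylGroup}
    (hw : w ∈ Subgroup.closure (b.simpleReflectionsOmitting k.succ)) (x : E) :
    b.basis.repr (w • x) k = b.basis.repr x k := by
  obtain ⟨l, hl, rfl⟩ := exists_list_of_mem_closure (inv_mem_simpleReflectionsOmitting _) hw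
  clear hw
  induction l with
  | nil => simp
  | cons s l ih =>
    rw [List.forall_mem_cons] at hl
    obtain ⟨i, hi, hs⟩ := hl.1
    rw [List.prod_cons, mul_smul, hs, repr_simpleReflection_of_ne, ih hl.2]
    rintro rfl
    exact hi rfl

end RootPairing.SimpleRoots

/-! ### Existence and dominance of the highest root -/

namespace RootPairing.SimpleRoots

variable {ι E : Type*} [NormedAddCommGroup E] [InnerProductSpace ℝ E]
  {P : RootPairing ι ℝ E E} {ℓ : ℕ} (b : P.SimpleRoots ℓ)

/-- A root is maximal if no other root has coefficients at least as large. -/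
def IsMaximalRoot (i : ι) : Prop :=
  ∀ k, (∀ j, b.basis.repr (P.root i) j ≤ b.basis.repr (P.root k) j) → k = i

theorem exists_isMaximalRoot_ge [Finite ι] (k : ι) :
    ∃ i, b.IsMaximalRoot i ∧ ∀ j, b.basis.repr (P.root k) j ≤ b.basis.repr (P.root i) j := by
  let f : ι → Fin ℓ → ℝ := fun i j => b.basis.repr (P.root i) j
  have hf : Function.Injective f := fun i i' h =>
    P.root.injective (b.basis.ext_elem fun j => congrFun h j)
  obtain ⟨_, hle, ⟨i, rfl⟩, hi⟩ := (Set.finite_range f).exists_le_maximal ⟨k, rfl⟩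
  exact ⟨i, fun k' hk' => hf (le_antisymm (hi ⟨k', rfl⟩ hk') hk'), hle⟩

variable {b}

theorem IsMaximalRoot.isPos {i : ι} (hi : b.IsMaximalRoot i) : b.IsPos (P.root i) := by
  by_contra h
  have hneg := isPos_neg_of_not ⟨i, rfl⟩ h
  obtain ⟨k, hk⟩ := hneg.1
  have : k = i := hi k fun j => by
    have := hneg.2 j
    rw [hk]
    simp only [map_neg, Finsupp.neg_apply] at this ⊢
    linarith
  rw [← hk, this] at hneg
  exact h hneg

theorem highestRoot_eq_zero_or_mem_range_root :
    b.highestRoot = 0 ∨ b.highestRoot ∈ Set.range P.root := by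
  unfold highestRoot
  split_ifs with h
  · exact .inr ⟨_, rfl⟩
  · exact .inl rfl

variable [P.IsEuclidean]

/-- The root `s_k α_i` has coefficient `1` at `α_i`, so it is positive and its coefficient at `α_k`
is nonnegative. -/
theorem inner_basis_nonpos {i k : Fin ℓ} (h : i ≠ k) : ⟪b.basis i, b.basis k⟫_ℝ ≤ 0 := by
  have hpos : b.IsPos (b.simpleReflection k • b.basis i) := by
    refine isPos_of_repr_pos (P.weylGroup_smul_mem_range_root _ (basis_mem_range_root i))
      (j := i) ?_
    rw [repr_simpleReflection_of_ne h]
    simp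
  have h1 := hpos.2 k
  rw [repr_simpleReflection_self, Module.Basis.repr_self, Finsupp.single_eq_of_ne h.symm,
    zero_sub, Left.nonneg_neg_iff] at h1
  exact nonpos_of_mul_nonpos_right h1
    (div_pos two_pos (real_inner_self_pos.2 (b.basis.ne_zero k)))

/-- Otherwise the reflection in `α_k` would strictly increase the coefficient at `α_k` and fix the
others. -/
theorem IsMaximalRoot.inner_basis_nonneg {i : ι} (hi : b.IsMaximalRoot i) (k : Fin ℓ) :
    0 ≤ ⟪P.root i, b.basis k⟫_ℝ := by
  by_contra! h
  have hpos : 2 / ⟪b.basis k, b.basis k⟫_ℝ * ⟪P.root i, b.basis k⟫_ℝ < 0 :=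
    mul_neg_of_pos_of_neg (div_pos two_pos (real_inner_self_pos.2 (b.basis.ne_zero k))) h
  obtain ⟨m, hm⟩ := P.weylGroup_smul_mem_range_root (b.simpleReflection k) ⟨i, rfl⟩
  have hmi : m = i := hi m fun j => by
    rw [hm]
    rcases eq_or_ne j k with rfl | hj
    · rw [repr_simpleReflection_self]
      linarith
    · rw [repr_simpleReflection_of_ne hj]
  have := repr_simpleReflection_self (b := b) k (P.root i)
  rw [← hm, hmi] at this
  linarith

/-- The simple roots in the support of a maximal root are orthogonal to the remaining ones, so they
span a nonzero `W`-invariant subspace. By irreducibility this is all of `E`. -/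
theorem IsMaximalRoot.repr_pos [P.IsIrreducible] {i : ι} (hi : b.IsMaximalRoot i) (k : Fin ℓ) :
    0 < b.basis.repr (P.root i) k := by
  set s : Set (Fin ℓ) := {j | 0 < b.basis.repr (P.root i) j} with hs
  have hzero : ∀ j, j ∉ s → b.basis.repr (P.root i) j = 0 := fun j hj =>
    le_antisymm (not_lt.1 hj) (hi.isPos.2 j)
  have hort : ∀ j ∈ s, ∀ k ∉ s, ⟪b.basis j, b.basis k⟫_ℝ = 0 := by
    intro j hj k hk
    have hle : ∀ m ∈ Finset.univ, b.basis.repr (P.root i) m * ⟪b.basis m, b.basis k⟫_ℝ ≤ 0 := by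
      intro m _
      rcases eq_or_ne m k with rfl | hm
      · rw [hzero m hk, zero_mul]
      · exact mul_nonpos_of_nonneg_of_nonpos (hi.isPos.2 m) (inner_basis_nonpos hm)
    -- For `k` outside the support, the inner product of the maximal root with `α_k` is nonnegative
    -- but is a sum of nonpositive terms, so every term vanishes.
    have h0 : ∑ m, b.basis.repr (P.root i) m * ⟪b.basis m, b.basis k⟫_ℝ = 0 :=
      le_antisymm (Finset.sum_nonpos hle) (inner_eq_sum (b := b) _ _ ▸ hi.inner_basis_nonneg k)
    have := (Finset.sum_eq_zero_iff_of_nonpos hle).1 h0 j (Finset.mem_univ j)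
    exact (mul_eq_zero.1 this).resolve_left (ne_of_gt hj)
  set q : Submodule ℝ E := Submodule.span ℝ (b.basis '' s) with hq
  have hsimple : ∀ k, ∀ x ∈ q, b.simpleReflection k • x ∈ q := by
    intro k x hx
    rw [simpleReflection_smul]
    by_cases hk : k ∈ s
    · exact q.sub_mem hx (q.smul_mem _ (Submodule.subset_span ⟨k, hk, rfl⟩))
    · have : ⟪x, b.basis k⟫_ℝ = 0 := by
        induction hx using Submodule.span_induction with
        | mem x hx =>
          obtain ⟨j, hj, rfl⟩ := hx
          exact hort j hj k hk
        | zero => simp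
        | add x y _ _ hx hy => rw [inner_add_left, hx, hy, add_zero]
        | smul c x _ hx => rw [real_inner_smul_left, hx, mul_zero]
      rwa [this, mul_zero, zero_smul, sub_zero]
  have hW : ∀ w : P.weylGroup, ∀ x ∈ q, w • x ∈ q := by
    intro w
    have hw : w ∈ Subgroup.closure (Set.range b.simpleReflection) := by
      rw [closure_range_simpleReflection]
      exact Subgroup.mem_top w
    induction hw using Subgroup.closure_induction'' with
    | one => intro x hx; rwa [one_smul]
    | mem _ h => obtain ⟨k, rfl⟩ := h; exact hsimple k
    | inv_mem _ h =>
      obtain ⟨k, rfl⟩ := h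
      rw [weylGroup_ofIdx_inv]
      exact hsimple k
    | mul v w _ _ hv hw => intro x hx; rw [mul_smul]; exact hv _ (hw _ hx)
  have hmem : P.root i ∈ q := by
    rw [← b.basis.sum_repr (P.root i)]
    refine q.sum_mem fun j _ => ?_
    by_cases hj : j ∈ s
    · exact q.smul_mem _ (Submodule.subset_span ⟨j, hj, rfl⟩)
    · rw [hzero j hj, zero_smul]
      exact q.zero_mem
  have htop : q = ⊤ := by
    refine IsIrreducible.eq_top_of_invtSubmodule_reflection (P := P) q (fun m x hx => ?_) ?_
    · exact hW (weylGroup.ofIdx P m) x hx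
    · rintro h
      rw [h, Submodule.mem_bot] at hmem
      exact P.ne_zero i hmem
  have hk : b.basis k ∈ q := htop ▸ Submodule.mem_top
  exact b.basis.self_mem_span_image.1 hk

/-- Two maximal roots have positive inner product, by full support and dominance. If they were
distinct, their difference would be a root, and its sign would make one of them dominate the other.
-/
theorem IsMaximalRoot.unique [Finite ι] [P.IsCrystallographic] [P.IsIrreducible] {i i' : ι}
    (hi : b.IsMaximalRoot i) (hi' : b.IsMaximalRoot i') : i = i' := by
  by_contra hne
  obtain ⟨k, hk⟩ := hi'.isPos.exists_inner_pos
  have hpos : 0 < ⟪P.root i, P.root i'⟫_ℝ := by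
    rw [inner_eq_sum (b := b)]
    refine Finset.sum_pos' (fun j _ => mul_nonneg (hi.isPos.2 j) ?_)
      ⟨k, Finset.mem_univ k, mul_pos (hi.repr_pos k) ?_⟩
    · rw [real_inner_comm]
      exact hi'.inner_basis_nonneg j
    · rwa [real_inner_comm]
  have hpair : 0 < P.pairingIn ℤ i i' := by
    have : (0 : ℝ) < P.pairingIn ℤ i i' := by
      have h : ((P.pairingIn ℤ i i' : ℤ) : ℝ) = P.pairing i i' := P.algebraMap_pairingIn ℤ i i'
      rw [h, P.pairing_eq_inner]
      exact mul_pos (div_pos two_pos (P.inner_root_self_pos i')) hpos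
    exact_mod_cast this
  rcases isPos_or_isPos_neg (b := b) (P.root_sub_root_mem_of_pairingIn_pos hpair hne) with h | h
  · refine hne (hi' i fun j => ?_)
    simpa using h.2 j
  · refine hne (hi i' fun j => ?_).symm
    simpa using h.2 j

theorem exists_highestRoot [Finite ι] [P.IsCrystallographic] [P.IsIrreducible] [Nonempty ι] :
    ∃ i, ∀ k j, b.basis.repr (P.root k) j ≤ b.basis.repr (P.root i) j := by
  obtain ⟨i, hi, -⟩ := b.exists_isMaximalRoot_ge (Classical.arbitrary ι)
  refine ⟨i, fun k => ?_⟩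
  obtain ⟨i', hi', h⟩ := b.exists_isMaximalRoot_ge k
  rwa [hi'.unique hi] at h

theorem repr_root_le_repr_highestRoot [Finite ι] [P.IsCrystallographic]
    (hirr : P.IsIrreducible ∨ IsEmpty ι) (k : ι) (j : Fin ℓ) :
    b.basis.repr (P.root k) j ≤ b.basis.repr b.highestRoot j := by
  rcases hirr with hirr | hemp
  · have : Nonempty ι := ⟨k⟩
    have h := exists_highestRoot (b := b)
    rw [highestRoot, dif_pos h]
    exact h.choose_spec k j
  · exact isEmptyElim k

end RootPairing.SimpleRoots

/-! ### Values of roots on the alcove -/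

namespace RootPairing.SimpleRoots

variable {ι E : Type*} [NormedAddCommGroup E] [InnerProductSpace ℝ E]
  {P : RootPairing ι ℝ E E} {ℓ : ℕ} {b : P.SimpleRoots ℓ}

theorem IsPos.inner_pos {v x : E} (hv : b.IsPos v) (hx : ∀ j, 0 < ⟪b.basis j, x⟫_ℝ) :
    0 < ⟪v, x⟫_ℝ := by
  obtain ⟨k, hk⟩ := hv.exists_repr_pos
  rw [inner_eq_sum (b := b)]
  exact Finset.sum_pos' (fun j _ => mul_nonneg (hv.2 j) (hx j).le)
    ⟨k, Finset.mem_univ k, mul_pos hk (hx k)⟩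

/-- The fundamental coweights, together with `0` for `j = 0`. -/
theorem exists_coweight (b : P.SimpleRoots ℓ) (j : Fin (ℓ + 1)) :
    ∃ z ∈ P.coweightLattice, ∀ i : Fin ℓ, ⟪b.basis i, z⟫_ℝ = if i.succ = j then 1 else 0 := by
  obtain ⟨z, hz⟩ := b.exists_inner_basis fun i => if i.succ = j then 1 else 0
  exact ⟨z, b.mem_coweightLattice_of_basis fun i =>
    ⟨if i.succ = j then 1 else 0, by rw [hz]; push_cast; rfl⟩, hz⟩

/-- The highest root dominates all roots. -/
def HasHighestRoot (b : P.SimpleRoots ℓ) : Prop :=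
  ∀ k j, b.basis.repr (P.root k) j ≤ b.basis.repr b.highestRoot j

theorem HasHighestRoot.one_le_repr (hb : b.HasHighestRoot) (j : Fin ℓ) :
    1 ≤ b.basis.repr b.highestRoot j := by
  simpa [← b.basis_apply] using hb (b.idx j) j

theorem HasHighestRoot.exists_mem_fundamentalAlcove (hb : b.HasHighestRoot) :
    ∃ x, x ∈ b.fundamentalAlcove := by
  set s := ∑ j, b.basis.repr b.highestRoot j with hs
  have hs0 : 0 ≤ s := Finset.sum_nonneg fun j _ => zero_le_one.trans (hb.one_le_repr j)
  -- At this point the highest root takes the value `s / (s + 1) < 1`; adding `1` also covers `s =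
  -- 0`, the empty root system.
  obtain ⟨x, hx⟩ := b.exists_inner_basis fun _ => (s + 1)⁻¹
  refine ⟨x, fun j => ?_, ?_⟩
  · rw [hx]
    positivity
  · rw [inner_eq_sum (b := b)]
    simp only [hx]
    rw [← Finset.sum_mul, ← hs, ← div_eq_mul_inv, div_lt_one (by positivity)]
    linarith

theorem HasHighestRoot.inner_root_lt_one (hb : b.HasHighestRoot) {x : E}
    (hx : x ∈ b.fundamentalAlcove) {v : E} (hv : v ∈ Set.range P.root) : ⟪v, x⟫_ℝ < 1 := by
  obtain ⟨i, rfl⟩ := hv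
  refine lt_of_le_of_lt ?_ hx.2
  rw [inner_eq_sum (b := b), inner_eq_sum (b := b) b.highestRoot]
  exact Finset.sum_le_sum fun j _ => mul_le_mul_of_nonneg_right (hb i j) (hx.1 j).le

theorem HasHighestRoot.neg_one_lt_inner_root (hb : b.HasHighestRoot) {x : E}
    (hx : x ∈ b.fundamentalAlcove) {v : E} (hv : v ∈ Set.range P.root) : -1 < ⟪v, x⟫_ℝ := by
  have := hb.inner_root_lt_one hx (P.neg_mem_range_root hv)
  rw [inner_neg_left] at this
  linarith

/-- Two points of the alcove are on the same side of each affine hyperplane `(v, x) = -m`. -/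
theorem HasHighestRoot.inner_root_add_int_mem_Ioo (hb : b.HasHighestRoot) {x y : E}
    (hx : x ∈ b.fundamentalAlcove) (hy : y ∈ b.fundamentalAlcove) {v : E}
    (hv : v ∈ Set.range P.root) {m : ℤ} (h : ⟪v, x⟫_ℝ + m ∈ Set.Ioo 0 1) :
    ⟪v, y⟫_ℝ + m ∈ Set.Ioo 0 1 := by
  have hx1 := hb.inner_root_lt_one hx hv
  have hy1 := hb.inner_root_lt_one hy hv
  have hx2 := hb.neg_one_lt_inner_root hx hv
  have hy2 := hb.neg_one_lt_inner_root hy hv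
  obtain ⟨h1, h2⟩ := h
  rcases isPos_or_isPos_neg (b := b) hv with hp | hp
  · have hx3 := hp.inner_pos hx.1
    have hy3 := hp.inner_pos hy.1
    have hm1 : m < 1 := by exact_mod_cast (by linarith : (m : ℝ) < 1)
    have hm2 : -1 < m := by exact_mod_cast (by linarith : (-1 : ℝ) < m)
    obtain rfl : m = 0 := by omega
    simp only [Int.cast_zero, add_zero]
    exact ⟨hy3, hy1⟩
  · have hx3 := hp.inner_pos hx.1
    have hy3 := hp.inner_pos hy.1
    rw [inner_neg_left] at hx3 hy3
    have hm1 : m < 2 := by exact_mod_cast (by linarith : (m : ℝ) < 2)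
    have hm2 : 0 < m := by exact_mod_cast (by linarith : (0 : ℝ) < m)
    obtain rfl : m = 1 := by omega
    simp only [Int.cast_one]
    constructor <;> linarith

theorem HasHighestRoot.fundamentalAlcove_subset_parallelepiped (hb : b.HasHighestRoot) :
    b.fundamentalAlcove ⊆ b.parallelepiped := fun _ hx j =>
  ⟨hx.1 j, (hb.inner_root_lt_one hx (basis_mem_range_root j)).le⟩

/-! ### Stabilizers of the alcove -/

variable [P.IsEuclidean]

theorem inner_extended_smul (g : P.ExtendedAffineWeylGroup) (v x : E) :
    ⟪v, g • x⟫_ℝ = ⟪g.right⁻¹ • v, x⟫_ℝ +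
      ⟪v, ((Multiplicative.toAdd g.left : P.coweightLattice) : E)⟫_ℝ := by
  rw [← P.inner_weylGroup_smul_right, ← inner_add_right]
  rfl

/-- An element of the extended affine Weyl group that maps some point of the alcove into the alcove
maps the alcove into itself. -/
theorem HasHighestRoot.extended_smul_mem (hb : b.HasHighestRoot) {g : P.ExtendedAffineWeylGroup}
    {x y : E} (hx : x ∈ b.fundamentalAlcove) (hgx : g • x ∈ b.fundamentalAlcove)
    (hy : y ∈ b.fundamentalAlcove) : g • y ∈ b.fundamentalAlcove := by
  have key : ∀ v ∈ Set.range P.root, ⟪v, g • x⟫_ℝ ∈ Set.Ioo 0 1 → ⟪v, g • y⟫_ℝ ∈ Set.Ioo 0 1 := by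
    intro v hv h
    obtain ⟨i, rfl⟩ := hv
    obtain ⟨m, hm⟩ := (Multiplicative.toAdd g.left : P.coweightLattice).2 i
    rw [inner_extended_smul, hm] at h ⊢
    exact hb.inner_root_add_int_mem_Ioo hx hy (P.weylGroup_smul_mem_range_root _ ⟨i, rfl⟩) h
  refine ⟨fun j => (key _ (basis_mem_range_root j)
    ⟨hgx.1 j, hb.inner_root_lt_one hgx (basis_mem_range_root j)⟩).1, ?_⟩
  rcases highestRoot_eq_zero_or_mem_range_root (b := b) with h | h
  · rw [h, inner_zero_left]
    exact one_pos
  · refine (key _ h ⟨IsPos.inner_pos ⟨h, fun j => ?_⟩ hgx.1, hgx.2⟩).2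
    exact zero_le_one.trans (hb.one_le_repr j)

theorem HasHighestRoot.mem_stabilizer_fundamentalAlcove (hb : b.HasHighestRoot)
    {g : P.ExtendedAffineWeylGroup} {x : E} (hx : x ∈ b.fundamentalAlcove)
    (hgx : g • x ∈ b.fundamentalAlcove) :
    g ∈ MulAction.stabilizer P.ExtendedAffineWeylGroup b.fundamentalAlcove := by
  rw [MulAction.mem_stabilizer_iff]
  refine Set.Subset.antisymm ?_ fun y hy => ?_
  · rintro _ ⟨y, hy, rfl⟩
    exact hb.extended_smul_mem hx hgx hy
  · rw [Set.mem_smul_set_iff_inv_smul_mem]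
    exact hb.extended_smul_mem hgx (by rwa [inv_smul_smul]) hy

theorem extended_smul_mem_of_mem_stabilizer {g : P.ExtendedAffineWeylGroup}
    (hg : g ∈ MulAction.stabilizer P.ExtendedAffineWeylGroup b.fundamentalAlcove) {x : E}
    (hx : x ∈ b.fundamentalAlcove) : g • x ∈ b.fundamentalAlcove := by
  rw [MulAction.mem_stabilizer_iff] at hg
  exact hg ▸ Set.smul_mem_smul_set hx

theorem toTorus_extended_smul (g : P.ExtendedAffineWeylGroup) (x : E) :
    P.toTorus (g • x) = g.right • P.toTorus x := by
  refine QuotientAddGroup.eq.2 ?_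
  change -(g.right • x + ((Multiplicative.toAdd g.left : P.coweightLattice) : E)) + g.right • x ∈ _
  rw [neg_add_rev, neg_add_cancel_right]
  exact neg_mem (Multiplicative.toAdd g.left : P.coweightLattice).2

/-- The stabilizer of the image of the alcove in the torus is the projection of the stabilizer of
the alcove in the extended affine Weyl group. -/
theorem HasHighestRoot.stabilizer_toTorus_image (hb : b.HasHighestRoot) :
    MulAction.stabilizer P.weylGroup (P.toTorus '' b.fundamentalAlcove) =
      (MulAction.stabilizer P.ExtendedAffineWeylGroup b.fundamentalAlcove).map P.projWeyl := by
  ext w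
  rw [MulAction.mem_stabilizer_iff, Subgroup.mem_map]
  constructor
  · intro h
    obtain ⟨x, hx⟩ := hb.exists_mem_fundamentalAlcove
    have hwx : w • P.toTorus x ∈ P.toTorus '' b.fundamentalAlcove :=
      h ▸ Set.smul_mem_smul_set ⟨x, hx, rfl⟩
    obtain ⟨a, ha, hax⟩ := hwx
    have hz : -(w • x) + a ∈ P.coweightLattice := QuotientAddGroup.eq.1 hax.symm
    -- The translation part is chosen so that `g` carries `x` to the alcove point `a`; one such
    -- point suffices.
    let g : P.ExtendedAffineWeylGroup := ⟨Multiplicative.ofAdd ⟨_, hz⟩, w⟩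
    refine ⟨g, hb.mem_stabilizer_fundamentalAlcove hx ?_, rfl⟩
    have : g • x = a := add_neg_cancel_left (w • x) a
    rwa [this]
  · rintro ⟨g, hg, rfl⟩
    rw [MulAction.mem_stabilizer_iff] at hg
    calc P.projWeyl g • P.toTorus '' b.fundamentalAlcove
        = P.toTorus '' (g • b.fundamentalAlcove) := by
          simp only [← Set.image_smul, Set.image_image]
          exact Set.image_congr fun x _ => (toTorus_extended_smul g x).symm
      _ = _ := by rw [hg]

/-- The action `ρ^⋄` is the torus action transported along a bijection, so stabilizers correspond
for subsets of `P^⋄`. -/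
theorem mem_stabilizer_iff_of_subset {C : Set E} (hC : C ⊆ b.parallelepiped) (w : P.weylGroup) :
    w ∈ b.stabilizer C ↔ w ∈ MulAction.stabilizer P.weylGroup (P.toTorus '' C) := by
  set C' : Set b.parallelepiped := {x | (x : E) ∈ C} with hC'
  have h1 : Subtype.val '' C' = C := by
    ext x
    exact ⟨by rintro ⟨x, hx, rfl⟩; exact hx, fun hx => ⟨⟨x, hC hx⟩, hx, rfl⟩⟩
  have h2 : P.toTorus '' C = b.parallelepipedEquiv '' C' := by
    conv_lhs => rw [← h1, Set.image_image]
    rfl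
  have h3 : (fun x : b.parallelepiped => (b.rho w x : E)) '' C' =
      Subtype.val '' (b.parallelepipedEquiv.symm '' (w • b.parallelepipedEquiv '' C')) := by
    simp only [← Set.image_smul, Set.image_image]
    rfl
  rw [MulAction.mem_stabilizer_iff, h2, ← Set.image_eq_image b.parallelepipedEquiv.symm.injective,
    Equiv.symm_image_image, ← Set.image_eq_image Subtype.val_injective, ← h3, h1]
  rfl

/-- For `j ∈ J` the affine map `x ↦ w_j w_0 x + ϖ_j`, where `ϖ_j` is the fundamental coweight,
stabilizes the alcove. -/
theorem HasHighestRoot.mem_stabilizer_of_isLongestElement (hb : b.HasHighestRoot)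
    {j : Fin (ℓ + 1)} (hj : j ∈ b.J) {wj w0 : P.weylGroup}
    (hwj : IsLongestElement (b.simpleReflectionsOmitting j) wj)
    (hw0 : IsLongestElement (b.simpleReflectionsOmitting 0) w0) {z : E}
    (hz : z ∈ P.coweightLattice)
    (hzj : ∀ i : Fin ℓ, ⟪b.basis i, z⟫_ℝ = if i.succ = j then 1 else 0) :
    (⟨Multiplicative.ofAdd ⟨z, hz⟩, wj * w0⟩ : P.ExtendedAffineWeylGroup) ∈
      MulAction.stabilizer P.ExtendedAffineWeylGroup b.fundamentalAlcove := by
  set g : P.ExtendedAffineWeylGroup := ⟨Multiplicative.ofAdd ⟨z, hz⟩, wj * w0⟩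
  obtain ⟨x, hx⟩ := hb.exists_mem_fundamentalAlcove
  have hg : ∀ v, ⟪v, g • x⟫_ℝ = ⟪w0⁻¹ • wj⁻¹ • v, x⟫_ℝ + ⟪v, z⟫_ℝ := by
    intro v
    rw [inner_extended_smul, ← mul_smul, ← mul_inv_rev]
    rfl
  have hroot : ∀ v ∈ Set.range P.root, w0⁻¹ • wj⁻¹ • v ∈ Set.range P.root := fun v hv =>
    P.weylGroup_smul_mem_range_root _ (P.weylGroup_smul_mem_range_root _ hv)
  have hw0' := hw0.inv (inv_mem_simpleReflectionsOmitting _)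
  have hwj' := hwj.inv (inv_mem_simpleReflectionsOmitting _)
  refine hb.mem_stabilizer_fundamentalAlcove hx ⟨fun i => ?_, ?_⟩
  · rw [hg, hzj]
    split_ifs with hij
    · linarith [hb.neg_one_lt_inner_root hx (hroot _ (basis_mem_range_root (b := b) i))]
    -- For `i ≠ j` there is no shift, but two sign changes, by `w_j⁻¹` and then `w_0⁻¹`, leave a
    -- positive root.
    · have := (isPos_neg_smul_of_isLongestElement hwj' hij).neg_smul_of_isLongestElement hw0'
      rw [smul_neg, neg_neg] at this
      linarith [this.inner_pos hx.1]
  · rcases highestRoot_eq_zero_or_mem_range_root (b := b) with h | h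
    · rw [h, inner_zero_left]
      exact one_pos
    · have hsum : ⟪b.highestRoot, z⟫_ℝ =
          ∑ i, if i.succ = j then b.basis.repr b.highestRoot i else 0 := by
        rw [inner_eq_sum (b := b)]
        exact Finset.sum_congr rfl fun i _ => by rw [hzj, mul_ite, mul_one, mul_zero]
      rw [hg, hsum]
      induction j using Fin.cases with
      | zero =>
        simpa [Fin.succ_ne_zero] using hb.inner_root_lt_one hx (hroot _ h)
      | succ k =>
        have hk : b.basis.repr b.highestRoot k = 1 := hj
        -- The element `w_j⁻¹` keeps the coefficient `n_j = 1`, so the image of `α̃` stays positive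
        -- and `w_0⁻¹` makes it negative. Its value on the alcove is thus below `0`, and the shift
        -- by `n_j = 1` leaves it below `1`.
        have hpos : b.IsPos (wj⁻¹ • b.highestRoot) :=
          isPos_of_repr_pos (P.weylGroup_smul_mem_range_root _ h) (j := k)
            (by rw [repr_smul_of_mem_closure hwj'.1, hk]; exact one_pos)
        have := (hpos.neg_smul_of_isLongestElement hw0').inner_pos hx.1
        rw [inner_neg_left] at this
        simp only [Fin.succ_inj, Finset.sum_ite_eq', Finset.mem_univ, if_true, hk]
        linarith

/-- The translation part of an element of the extended affine Weyl group stabilizing the alcove is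
`0` or a minuscule fundamental coweight. -/
theorem HasHighestRoot.exists_mem_J_of_mem_stabilizer (hb : b.HasHighestRoot)
    {g : P.ExtendedAffineWeylGroup}
    (hg : g ∈ MulAction.stabilizer P.ExtendedAffineWeylGroup b.fundamentalAlcove) :
    ∃ j ∈ b.J, ∀ i : Fin ℓ,
      ⟪b.basis i, ((Multiplicative.toAdd g.left : P.coweightLattice) : E)⟫_ℝ =
        if i.succ = j then 1 else 0 := by
  obtain ⟨x, hx⟩ := hb.exists_mem_fundamentalAlcove
  have hgx := extended_smul_mem_of_mem_stabilizer hg hx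
  set z := ((Multiplicative.toAdd g.left : P.coweightLattice) : E) with hz
  have h01 : ∀ i, ⟪b.basis i, z⟫_ℝ = 0 ∨ ⟪b.basis i, z⟫_ℝ = 1 := by
    intro i
    obtain ⟨m, hm⟩ := (Multiplicative.toAdd g.left : P.coweightLattice).2 (b.idx i)
    have hmem := P.weylGroup_smul_mem_range_root g.right⁻¹ (basis_mem_range_root (b := b) i)
    have h1 := hgx.1 i
    have h2 := hb.inner_root_lt_one hgx (basis_mem_range_root (b := b) i)
    have h3 := hb.inner_root_lt_one hx hmem
    have h4 := hb.neg_one_lt_inner_root hx hmem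
    rw [inner_extended_smul, ← hz] at h1 h2
    rw [← b.basis_apply, ← hz] at hm
    rw [hm] at h1 h2 ⊢
    have hm1 : m < 2 := by exact_mod_cast (by linarith : (m : ℝ) < 2)
    have hm2 : -1 < m := by exact_mod_cast (by linarith : (-1 : ℝ) < m)
    obtain rfl | rfl : m = 0 ∨ m = 1 := by omega
    · simp
    · simp
  -- As every `n_i ≥ 1`, this bound allows at most one `(α_i, z) = 1`, and its integer mark must be
  -- `1`.
  have hlt : ⟪b.highestRoot, z⟫_ℝ < 2 := by
    rcases highestRoot_eq_zero_or_mem_range_root (b := b) with h | h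
    · rw [h, inner_zero_left]
      exact two_pos
    · have h1 := hgx.2
      rw [inner_extended_smul, ← hz] at h1
      linarith [hb.neg_one_lt_inner_root hx (P.weylGroup_smul_mem_range_root g.right⁻¹ h)]
  by_cases hex : ∃ k, ⟪b.basis k, z⟫_ℝ = 1
  · obtain ⟨k, hk⟩ := hex
    have hnn : ∀ i ∈ Finset.univ, 0 ≤ b.basis.repr b.highestRoot i * ⟪b.basis i, z⟫_ℝ :=
      fun i _ => mul_nonneg (zero_le_one.trans (hb.one_le_repr i))
        (by rcases h01 i with h | h <;> rw [h]; exact zero_le_one)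
    rw [inner_eq_sum (b := b)] at hlt
    have hk2 := (Finset.single_le_sum hnn (Finset.mem_univ k)).trans_lt hlt
    rw [hk, mul_one] at hk2
    have hk1 := hb.one_le_repr k
    refine ⟨k.succ, ?_, fun i => ?_⟩
    · change b.basis.repr b.highestRoot k = 1
      have h0 : b.highestRoot ∈ Set.range P.root := by
        refine highestRoot_eq_zero_or_mem_range_root.resolve_left fun h => ?_
        rw [h, map_zero, Finsupp.coe_zero, Pi.zero_apply] at hk1
        linarith
      obtain ⟨n, hn⟩ := exists_int_repr (b := b) h0 k
      rw [hn] at hk1 hk2 ⊢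
      have hn1 : n < 2 := by exact_mod_cast hk2
      have hn2 : 1 ≤ n := by exact_mod_cast hk1
      obtain rfl : n = 1 := by omega
      simp
    · simp only [Fin.succ_inj]
      split_ifs with hik
      · rw [hik, hk]
      · refine (h01 i).resolve_right fun hi => ?_
        have h2 := (Finset.add_le_sum hnn (Finset.mem_univ i) (Finset.mem_univ k) hik).trans_lt hlt
        rw [hi, hk, mul_one, mul_one] at h2
        linarith [hb.one_le_repr i]
  · refine ⟨0, rfl, fun i => ?_⟩
    rw [if_neg (Fin.succ_ne_zero i)]
    exact (h01 i).resolve_right fun h => hex ⟨i, h⟩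

theorem HasHighestRoot.map_stabilizer_eq_Omega [Finite ι] [P.IsRootSystem]
    (hb : b.HasHighestRoot) :
    ((MulAction.stabilizer P.ExtendedAffineWeylGroup b.fundamentalAlcove).map P.projWeyl :
      Set P.weylGroup) = b.Omega := by
  ext w
  rw [SetLike.mem_coe, Subgroup.mem_map]
  constructor
  · rintro ⟨g, hg, rfl⟩
    obtain ⟨j, hj, hzj⟩ := hb.exists_mem_J_of_mem_stabilizer hg
    have := P.weylGroup_finite
    obtain ⟨wj, hwj⟩ := exists_isLongestElement (b.simpleReflectionsOmitting j)
    obtain ⟨w0, hw0⟩ := exists_isLongestElement (b.simpleReflectionsOmitting 0)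
    refine ⟨j, hj, wj, w0, hwj, hw0, ?_⟩
    have hgj := hb.mem_stabilizer_of_isLongestElement hj hwj hw0
      (Multiplicative.toAdd g.left : P.coweightLattice).2 hzj
    set gj : P.ExtendedAffineWeylGroup := ⟨Multiplicative.ofAdd ⟨_, _⟩, wj * w0⟩
    obtain ⟨x, hx⟩ := hb.exists_mem_fundamentalAlcove
    have hy := extended_smul_mem_of_mem_stabilizer (mul_mem (inv_mem hgj) hg) hx
    set y := (gj⁻¹ * g) • x with hydef
    have hgy : gj • y = g • x := by rw [hydef, mul_smul, smul_inv_smul]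
    -- Both elements have the same translation part, which cancels, so `gj⁻¹ * g` acts on `x`
    -- linearly.
    have hyx : y = ((wj * w0)⁻¹ * g.right) • x := by
      rw [mul_smul, eq_inv_smul_iff]
      exact add_right_cancel hgy
    -- The linear part `u` keeps `x` in the alcove, so `(u⁻¹ α_k, x) = (α_k, u x) > 0`. Hence `u⁻¹`
    -- sends simple roots to positive roots.
    have hone : ((wj * w0)⁻¹ * g.right)⁻¹ = 1 := by
      refine eq_one_of_forall_isPos_smul (b := b) fun k => ?_
      have hk := hy.1 k
      rw [hyx, P.inner_weylGroup_smul_right] at hk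
      refine (isPos_or_isPos_neg
        (P.weylGroup_smul_mem_range_root _ (basis_mem_range_root k))).resolve_right fun h => ?_
      have := h.inner_pos hx.1
      rw [inner_neg_left] at this
      linarith
    rw [inv_eq_one, inv_mul_eq_one] at hone
    exact hone.symm
  · rintro ⟨j, hj, wj, w0, hwj, hw0, rfl⟩
    obtain ⟨z, hz, hzj⟩ := b.exists_coweight j
    exact ⟨_, hb.mem_stabilizer_of_isLongestElement hj hwj hw0 hz hzj, rfl⟩

end RootPairing.SimpleRoots

theorem proposition4p6 {ι E : Type*} [Finite ι] [NormedAddCommGroup E] [InnerProductSpace ℝ E]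
    (P : RootPairing ι ℝ E E) [P.IsRootSystem] [P.IsCrystallographic] [P.IsEuclidean]
    (hirr : P.IsIrreducible ∨ IsEmpty ι) {ℓ : ℕ} (b : P.SimpleRoots ℓ) :
    b.stabilizer b.fundamentalAlcove = b.Omega ∧
    (MulAction.stabilizer P.weylGroup (P.toTorus '' b.fundamentalAlcove) : Set P.weylGroup) =
      b.Omega ∧
    ((MulAction.stabilizer P.ExtendedAffineWeylGroup b.fundamentalAlcove).map P.projWeyl :
      Set P.weylGroup) = b.Omega := by
  have hb : b.HasHighestRoot := RootPairing.SimpleRoots.repr_root_le_repr_highestRoot hirr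
  refine ⟨?_, ?_, hb.map_stabilizer_eq_Omega⟩
  · ext w
    rw [RootPairing.SimpleRoots.mem_stabilizer_iff_of_subset
      hb.fundamentalAlcove_subset_parallelepiped, hb.stabilizer_toTorus_image,
      ← hb.map_stabilizer_eq_Omega, SetLike.mem_coe]
  · rw [hb.stabilizer_toTorus_image, hb.map_stabilizer_eq_Omega]
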